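/- Let $G$ be a locally compact (Hausdorff) group. A \emph{$G$-flow} is a continuous action $G\times X\to X$ on a compact Hausdorff space $X$. A $G$-flow is a \emph{boundary} if it is non-empty, minimal (every orbit is dense) and strongly proximal (for every Borel probability measure on $X$, the closure of its $G$-orbit in the weak topology given by integration of continuous functions contains a Dirac measure). A \emph{Furstenberg boundary} $\partial_F G$ of $G$ is a boundary such that every boundary $Y$ of $G$ is a factor of it, i.e. there is a continuous $G$-equivariant surjection $\partial_F G\to Y$. Let $\mathrm{Sub}(G)$ be the space of closed subgroups of $G$ with the Chabauty topology, which is generated by the sets $\{H : H\cap K=\emptyset\}$ for $K\subseteq G$ compact and $\{H : H\cap U\neq\emptyset\}$ for $U\subseteq G$ open. For a point $x$ of a $G$-flow, let $G_x$ be its stabilizer. Then $G$ has a Furstenberg boundary $\partial_F G$ and, for any such $\partial_F G$, the stabilizer map $\partial_F G\to\mathrm{Sub}(G)$, $x\mapsto G_x$, is continuous. Moreover, the following are equivalent: (1) $G$ admits a topologically free boundary, i.e. a boundary $Y$ such that for every compact $K\subseteq G$ with $1_G\notin K$ the set $\{y\in Y : y\in K\cdot y\}$ has empty interior; (2) $G$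 acts freely on $\partial_F G$, i.e. $G_x=\{1_G\}$ for every $x\in\partial_F G$. -/

import Mathlib

open Topology MeasureTheory

universe u v w

/-- The Chabauty topology on the space of closed subsets of `Y`: it is generated by the sets
`{F | F ∩ K = ∅}` for `K` compact and `{F | F ∩ U ≠ ∅}` for `U` open. -/
abbrev chabautyTopology (Y : Type u) [TopologicalSpace Y] :
    TopologicalSpace (TopologicalSpace.Closeds Y) :=
  TopologicalSpace.generateFrom
    ({S | ∃ K : Set Y, IsCompact K ∧ S = {F : TopologicalSpace.Closeds Y | (F : Set Y) ∩ K = ∅}} ∪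
     {S | ∃ U : Set Y, IsOpen U ∧ S = {F : TopologicalSpace.Closeds Y | ((F : Set Y) ∩ U).Nonempty}})

/-- The space `Sub(G)` of closed subgroups of `G` carries the topology induced by the Chabauty
topology on the closed subsets of `G`. -/
instance ClosedSubgroup.instChabauty (G : Type u) [Group G] [TopologicalSpace G] :
    TopologicalSpace (ClosedSubgroup G) :=
  (chabautyTopology G).induced fun H => ⟨(H : Set G), H.isClosed'⟩

/-- The stabilizer map `x ↦ G_x` from a `G`-flow to the space of closed subgroups of `G`. -/
def stabilizerMap (G : Type u) (X : Type v) [Group G] [TopologicalSpace G]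
    [TopologicalSpace X] [T2Space X] [MulAction G X] [ContinuousSMul G X] (x : X) :
    ClosedSubgroup G :=
  { MulAction.stabilizer G x with
    isClosed' := isClosed_eq (f := fun g : G => g • x) (g := fun _ => x)
      (continuous_id.smul continuous_const) continuous_const }

/-- The action is free: all stabilizers are trivial. -/
def IsFreeAction (G : Type u) (X : Type v) [Group G] [MulAction G X] : Prop :=
  ∀ x : X, MulAction.stabilizer G x = ⊥

/-- The action is topologically free: for every compact `K ⊆ G` that does not contain `1`, the set
of all `x` with `x ∈ K • x` has empty interior. -/
def IsTopologicallyFree (G : Type u) (X : Type v) [Group G] [TopologicalSpace G]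
    [TopologicalSpace X] [MulAction G X] : Prop :=
  ∀ K : Set G, IsCompact K → (1 : G) ∉ K → interior {x : X | ∃ g ∈ K, x = g • x} = ∅

/-- The flow is strongly proximal: the closure, in the weak topology (tested against continuous
functions), of the `G`-orbit of every Borel probability measure on `X` contains a Dirac measure.
On a compact Hausdorff space every Borel probability measure has the same integrals of continuous
functions as a regular one, so it is immaterial whether regularity is required. -/
def IsStronglyProximal (G : Type u) (X : Type v) [Group G] [TopologicalSpace G]
    [TopologicalSpace X] [MulAction G X] [ContinuousSMul G X] : Prop :=
  letI : MeasurableSpace X := borel X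
  haveI : BorelSpace X := ⟨rfl⟩
  ∀ μ : ProbabilityMeasure X, ∃ x : X,
    diracProba x ∈ closure (Set.range fun g : G =>
      μ.map (f := fun y : X => g • y) (continuous_const_smul g).measurable.aemeasurable)

/-- A `G`-flow is a boundary if it is (non-empty,) minimal and strongly proximal. -/
structure IsBoundary (G : Type u) (X : Type v) [Group G] [TopologicalSpace G]
    [TopologicalSpace X] [MulAction G X] [ContinuousSMul G X] : Prop where
  nonempty : Nonempty X
  minimal : MulAction.IsMinimal G X
  stronglyProximal : IsStronglyProximal G X

/-- `X` is a factor of `Y`: there is a continuous equivariant surjection `Y → X`. -/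
def IsFactor (G : Type u) (X : Type v) (Y : Type w) [Group G] [TopologicalSpace X]
    [TopologicalSpace Y] [MulAction G X] [MulAction G Y] : Prop :=
  ∃ f : Y →[G] X, Continuous f ∧ Function.Surjective f

/-- `X` is the Furstenberg boundary of `G`: a boundary of which every boundary is a factor (this
determines the `G`-flow `X` up to isomorphism). It is enough to consider boundaries in the universe
of `G`: for a point `y` of a boundary `Y` the map `G → Y`, `g ↦ g • y`, has dense range, so it
extends to a surjection from the set of ultrafilters on `G` onto `Y`. -/
structure IsFurstenbergBoundary (G : Type u) (X : Type v) [Group G] [TopologicalSpace G]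
    [TopologicalSpace X] [MulAction G X] [ContinuousSMul G X] : Prop where
  isBoundary : IsBoundary G X
  isFactor_of_isBoundary : ∀ (Y : Type u) [TopologicalSpace Y] [CompactSpace Y] [T2Space Y]
    [MulAction G Y] [ContinuousSMul G Y], IsBoundary G Y → IsFactor G Y X

open Filter Set

/-! Existence: a minimal subflow of the product of all boundaries is again a boundary, because
measures on all the factors can be contracted to points simultaneously
(`exists_forall_concentratesAt`). This uses the multiplication and the compactness of the space of
ultrafilters on the group.

Continuity: upper semicontinuity of stabilizers holds in every flow; the content is lower
semicontinuity (`IsFurstenbergBoundary.eventually_exists_smul_eq`). The Furstenberg boundary behaves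
like an extremally disconnected space. An irreducible extension of it is a boundary, hence a factor
of it, and uniqueness of equivariant maps turns the factor map into a section. Applied to the
essential graph of a lower semicontinuous function and its translates, this yields a continuous
modification (`exists_continuous_modification`), provided that the function is uniformly continuous
along the action. Hence open sets that stay disjoint under a neighbourhood of `1` have disjoint
closures (`disjoint_closure`). The points moved by all of a compact set `Q` are covered by finitely
many sets `closure (W • U)` with `Q • U` disjoint from `U` (`exists_finite_colouring`). If `g • x =
x` while points arbitrarily near `x` were moved by everything near `g`, then `x` would lie in the
closures of both `K • U` and `g • K • U`, contradicting separation.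

Freeness: a nontrivial stabilizer now persists on an open set up to a compact `K` avoiding `1`, and
the image of this open set in any boundary is somewhere dense, which rules out topological freeness.
-/

/-! ### Concentration of measures along filters on the group -/

section Concentration

variable {G : Type*} [Group G] {X : Type*} [TopologicalSpace X] [MulAction G X]

/-- The translates `g • μ` converge to the Dirac measure at `x` along the filter `F` on `G`. -/
def ConcentratesAt [MeasurableSpace X] (F : Filter G) (μ : Measure X) (x : X) : Prop :=
  ∀ O : Set X, IsOpen O → x ∈ O → ∀ ε : ℝ, 0 < ε → ∀ᶠ g in F, μ.real {y : X | g • y ∉ O} < ε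

theorem exists_ultrafilter_concentratesAt [MeasurableSpace X] {μ : Measure X}
    [IsProbabilityMeasure μ] {x : X}
    (h : ∀ O : Set X, IsOpen O → x ∈ O → ∀ ε : ℝ, 0 < ε → ∃ g : G, μ.real {y : X | g • y ∉ O} < ε) :
    ∃ F : Ultrafilter G, ConcentratesAt (F : Filter G) μ x := by
  let ι := {p : Set X × ℝ // IsOpen p.1 ∧ x ∈ p.1 ∧ 0 < p.2}
  let S : ι → Set G := fun p => {g | μ.real {y | g • y ∉ p.1.1} < p.1.2}
  have : Nonempty ι := ⟨⟨(univ, 1), isOpen_univ, mem_univ x, one_pos⟩⟩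
  have hne : NeBot (⨅ p, 𝓟 (S p)) := by
    apply iInf_neBot_of_directed
    · intro p q
      refine ⟨⟨(p.1.1 ∩ q.1.1, min p.1.2 q.1.2), p.2.1.inter q.2.1, ⟨p.2.2.1, q.2.2.1⟩,
        lt_min p.2.2.2 q.2.2.2⟩, ?_, ?_⟩
      · refine principal_mono.2 fun g hg => ?_
        refine lt_of_le_of_lt (measureReal_mono (by intro y hy; simp only [mem_ofPred_eq, mem_inter_iff] at hy ⊢; tauto)) (lt_of_lt_of_le hg ?_)
        exact min_le_left _ _
      · refine principal_mono.2 fun g hg => ?_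
        refine lt_of_le_of_lt (measureReal_mono (by intro y hy; simp only [mem_ofPred_eq, mem_inter_iff] at hy ⊢; tauto)) (lt_of_lt_of_le hg ?_)
        exact min_le_right _ _
    · intro p
      obtain ⟨g, hg⟩ := h p.1.1 p.2.1 p.2.2.1 p.1.2 p.2.2.2
      exact principal_neBot_iff.2 ⟨g, hg⟩
  refine ⟨Ultrafilter.of (⨅ p, 𝓟 (S p)), fun O hO hx ε hε => Ultrafilter.of_le _ ?_⟩
  exact mem_iInf_of_mem (⟨(O, ε), hO, hx, hε⟩ : ι) (mem_principal_self _)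

variable [TopologicalSpace G] [ContinuousSMul G X]

theorem ConcentratesAt.tendsto_map [MeasurableSpace X] [BorelSpace X] {F : Filter G}
    {μ : ProbabilityMeasure X} {x : X} (h : ConcentratesAt F (μ : Measure X) x) :
    Tendsto (fun g : G => μ.map (f := fun y : X => g • y)
      (continuous_const_smul g).measurable.aemeasurable) F (𝓝 (diracProba x)) := by
  rw [ProbabilityMeasure.tendsto_iff_forall_integral_tendsto]
  intro f
  have hd : ∫ y, f y ∂(diracProba x : Measure X) = f x := by
    simp [diracProba, integral_dirac' _ _ f.continuous.stronglyMeasurable]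
  rw [hd, Metric.tendsto_nhds]
  intro ε hε
  set O : Set X := {y | dist (f y) (f x) < ε / 2}
  have hO : IsOpen O := isOpen_lt (by fun_prop) continuous_const
  -- The bound `2 * ‖f‖` controls the oscillation off `O`; adding `1` allows division by `C`.
  set C : ℝ := 2 * ‖f‖ + 1
  have hC : 0 < C := by positivity
  filter_upwards [h O hO (by simp [O, hε]) (ε / 2 / C) (by positivity)] with g hg
  have hg' := continuous_const_smul (T := X) g
  have hint : Integrable (fun y => f (g • y)) (μ : Measure X) :=
    (f.compContinuous ⟨_, hg'⟩).integrable _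
  rw [ProbabilityMeasure.toMeasure_map,
    integral_map hg'.measurable.aemeasurable f.continuous.aestronglyMeasurable]
  have hb : MeasurableSet {y : X | g • y ∉ O} := ((hO.preimage hg').measurableSet).compl
  have h1 : ∫ y, f (g • y) ∂(μ : Measure X) - f x = ∫ y, (f (g • y) - f x) ∂(μ : Measure X) := by
    rw [integral_sub hint (integrable_const _)]; simp
  have hint2 : Integrable (fun y => ε / 2 + {y : X | g • y ∉ O}.indicator (fun _ => C) y)
      (μ : Measure X) := (integrable_const _).add ((integrable_const _).indicator hb)
  rw [Real.dist_eq, h1]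
  calc |∫ y, (f (g • y) - f x) ∂(μ : Measure X)|
      ≤ ∫ y, |f (g • y) - f x| ∂(μ : Measure X) := abs_integral_le_integral_abs
    _ ≤ ∫ y, (ε / 2 + {y : X | g • y ∉ O}.indicator (fun _ => C) y) ∂(μ : Measure X) := by
        refine integral_mono (hint.sub (integrable_const _)).abs hint2 fun y => ?_
        by_cases hy : g • y ∈ O
        · have : |f (g • y) - f x| < ε / 2 := hy
          simp [indicator, hy, this.le]
        · have h2 : |f (g • y) - f x| ≤ 2 * ‖f‖ := by
            rw [← Real.dist_eq]; exact f.dist_le_two_norm _ _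
          simp only [indicator, mem_ofPred_eq, hy, not_false_eq_true, if_true, C]
          linarith
    _ = ε / 2 + (μ : Measure X).real {y : X | g • y ∉ O} * C := by
        rw [integral_add (integrable_const _) ((integrable_const _).indicator hb),
          integral_indicator_const _ hb]
        simp
    _ < ε := by
        have := mul_lt_mul_of_pos_right hg hC
        rw [div_mul_cancel₀ _ hC.ne'] at this
        linarith

variable [CompactSpace X] [T2Space X]

/-- This trades weak convergence for estimates on open sets (via Urysohn functions) and nets for
ultrafilters on `G`, which do not depend on the flow and so can serve many flows at once. -/
theorem isStronglyProximal_iff : IsStronglyProximal G X ↔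
    ∀ (_ : MeasurableSpace X) (_ : BorelSpace X) (μ : Measure X) (_ : IsProbabilityMeasure μ),
      ∃ (F : Ultrafilter G) (x : X), ConcentratesAt (F : Filter G) μ x := by
  constructor
  · intro h m hm μ hμ
    obtain rfl : m = borel X := hm.measurable_eq
    let _ : MeasurableSpace X := borel X
    let μ' : ProbabilityMeasure X := ⟨μ, hμ⟩
    obtain ⟨x, hx⟩ := h μ'
    suffices h : ∃ F : Ultrafilter G, ConcentratesAt (F : Filter G) μ x from
      ⟨h.choose, x, h.choose_spec⟩
    refine exists_ultrafilter_concentratesAt fun O hO hxO ε hε => ?_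
    obtain ⟨f, hf0, hf1, hf⟩ := exists_continuous_zero_one_of_isClosed hO.isClosed_compl
      (isClosed_singleton (x := x)) (by simpa using hxO)
    let f' : BoundedContinuousFunction X ℝ := BoundedContinuousFunction.mkOfCompact f
    have hopen : IsOpen {ν : ProbabilityMeasure X | 1 - ε < ∫ y, f' y ∂(ν : Measure X)} :=
      isOpen_lt continuous_const
        (ProbabilityMeasure.continuous_integral_boundedContinuousFunction f')
    obtain ⟨_, hν, g, rfl⟩ := mem_closure_iff.1 hx _ hopen (by
      have : ∫ y, f' y ∂(diracProba x : Measure X) = f x := by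
        simp [diracProba, f', integral_dirac' _ _ f.continuous.stronglyMeasurable]
      rw [mem_ofPred_eq, this, hf1 rfl]
      simpa using hε)
    refine ⟨g, ?_⟩
    have hg' := continuous_const_smul (T := X) g
    simp only [mem_ofPred_eq] at hν
    rw [ProbabilityMeasure.toMeasure_map,
      integral_map hg'.measurable.aemeasurable f'.continuous.aestronglyMeasurable] at hν
    have hb : MeasurableSet {y : X | g • y ∈ O} := (hO.preimage hg').measurableSet
    have h1 : ∫ y, f' (g • y) ∂μ ≤ μ.real {y : X | g • y ∈ O} := by
      rw [← integral_indicator_one hb]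
      refine integral_mono ((f'.compContinuous ⟨_, hg'⟩).integrable _)
        ((integrable_const (1 : ℝ)).indicator hb) fun y => ?_
      by_cases hy : g • y ∈ O
      · simpa [indicator, hy, f'] using (hf (g • y)).2
      · simpa [indicator, hy, f'] using (hf0 hy).le
    have h2 := probReal_compl_eq_one_sub (μ := μ) hb
    have h3 : {y : X | g • y ∉ O} = {y : X | g • y ∈ O}ᶜ := rfl
    rw [h3, h2]
    have hν' : 1 - ε < ∫ y, f' (g • y) ∂μ := hν
    linarith
  · intro h μ
    let _ : MeasurableSpace X := borel X
    have : BorelSpace X := ⟨rfl⟩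
    obtain ⟨F, x, hF⟩ := h _ ⟨rfl⟩ (μ : Measure X) inferInstance
    exact ⟨x, mem_closure_of_tendsto hF.tendsto_map (Eventually.of_forall fun g => ⟨g, rfl⟩)⟩

/-- The translates of `μ` have a weak limit along `F` by compactness; the conclusion is the
closed-set half of the portmanteau theorem. -/
theorem exists_limit_measure [MeasurableSpace X] [BorelSpace X] (F : Ultrafilter G)
    (μ : Measure X) [IsProbabilityMeasure μ] :
    ∃ ν : Measure X, IsProbabilityMeasure ν ∧ ∀ C : Set X, IsClosed C → ∀ c : ℝ,
      ν.real C < c → ∀ᶠ g in (F : Filter G), μ.real {y : X | g • y ∈ C} < c := by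
  let μ' : ProbabilityMeasure X := ⟨μ, inferInstance⟩
  let m : G → ProbabilityMeasure X := fun g =>
    μ'.map (f := fun y : X => g • y)
      (continuous_const_smul g).measurable.aemeasurable
  obtain ⟨ν₀, -, hν₀⟩ := isCompact_univ.ultrafilter_le_nhds (F.map m) (by simp)
  have hlim : Tendsto m F (𝓝 ν₀) := hν₀
  -- The weak limit need not be regular; a regular measure with the same integrals supplies the
  -- outer approximation of `C` by open sets.
  obtain ⟨ν, hreg, hfin, hν⟩ := Measure.exists_regular_eq_of_compactSpace (ν₀ : Measure X)
  have huniv : ν.real univ = 1 := by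
    simpa using (hν 1).symm
  have hprob : IsProbabilityMeasure ν :=
    ⟨by rwa [measureReal_def, ENNReal.toReal_eq_one_iff] at huniv⟩
  refine ⟨ν, hprob, fun C hC c hc => ?_⟩
  have hc' : ν C < ENNReal.ofReal c := by
    rw [← ENNReal.ofReal_toReal (measure_ne_top ν C)]
    exact (ENNReal.ofReal_lt_ofReal_iff_of_nonneg ENNReal.toReal_nonneg).2 hc
  obtain ⟨O, hCO, hO, hOc⟩ := C.exists_isOpen_lt_of_lt _ hc'
  have hOc' : ν.real O < c := by
    have := (ENNReal.toReal_lt_toReal (measure_ne_top ν O) ENNReal.ofReal_ne_top).2 hOc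
    rwa [ENNReal.toReal_ofReal (measureReal_nonneg.trans hc.le)] at this
  obtain ⟨f, hf0, hf1, hf⟩ := exists_continuous_zero_one_of_isClosed hO.isClosed_compl hC
    (disjoint_compl_left_iff_subset.2 hCO)
  let f' : BoundedContinuousFunction X ℝ := BoundedContinuousFunction.mkOfCompact f
  have h1 : ∫ y, f' y ∂(ν₀ : Measure X) < c := by
    rw [hν]
    refine lt_of_le_of_lt ?_ hOc'
    rw [← integral_indicator_one hO.measurableSet]
    refine integral_mono (f'.integrable _)
      ((integrable_const (1 : ℝ)).indicator hO.measurableSet) fun y => ?_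
    by_cases hy : y ∈ O
    · simpa [indicator, hy, f'] using (hf y).2
    · simpa [indicator, hy, f'] using (hf0 hy).le
  have h2 := (ProbabilityMeasure.tendsto_iff_forall_integral_tendsto.1 hlim) f'
  filter_upwards [h2.eventually_lt_const h1] with g hg
  have hg' := continuous_const_smul (T := X) g
  have hb : MeasurableSet {y : X | g • y ∈ C} := (hC.preimage hg').measurableSet
  rw [ProbabilityMeasure.toMeasure_map,
    integral_map hg'.measurable.aemeasurable f'.continuous.aestronglyMeasurable] at hg
  refine lt_of_le_of_lt ?_ hg
  rw [← integral_indicator_one hb]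
  refine integral_mono ((integrable_const (1 : ℝ)).indicator hb)
    ((f'.compContinuous ⟨_, hg'⟩).integrable _) fun y => ?_
  by_cases hy : g • y ∈ C
  · simpa [indicator, hy, f'] using (hf1 hy).ge
  · simpa [indicator, hy, f'] using (hf (g • y)).1

end Concentration

/-! ### Boundaries -/

section Boundary

variable {G : Type*} [Group G] [TopologicalSpace G]
  {X : Type*} [TopologicalSpace X] [CompactSpace X] [T2Space X] [MulAction G X] [ContinuousSMul G X]
  {Y : Type*} [TopologicalSpace Y] [CompactSpace Y] [T2Space Y] [MulAction G Y] [ContinuousSMul G Y]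

/-- Strong proximality concentrates `μ` near some point, and minimality moves that point into `O`.
-/
theorem IsBoundary.exists_measure_lt (hX : IsBoundary G X) [MeasurableSpace X] [BorelSpace X]
    (μ : Measure X) [IsProbabilityMeasure μ] {O : Set X} (hO : IsOpen O) (hne : O.Nonempty)
    {ε : ℝ} (hε : 0 < ε) : ∃ g : G, μ.real {y : X | g • y ∉ O} < ε := by
  obtain ⟨F, x, hx⟩ := isStronglyProximal_iff.1 hX.stronglyProximal _ ‹_› μ ‹_›
  have := hX.minimal
  obtain ⟨h, hh⟩ := hO.exists_smul_mem G x hne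
  obtain ⟨g, hg⟩ := (hx _ (hO.preimage (continuous_const_smul h)) hh ε hε).exists
  refine ⟨h * g, ?_⟩
  simpa [mul_smul] using hg

/-- Equivariant continuous maps from a minimal flow to a boundary are unique. -/
theorem IsBoundary.eq_of_equivariant (hY : IsBoundary G Y) [MulAction.IsMinimal G X]
    {f h : X → Y} (hf : Continuous f) (hh : Continuous h) (hfe : ∀ (g : G) x, f (g • x) = g • f x)
    (hhe : ∀ (g : G) x, h (g • x) = g • h x) : f = h := by
  rcases isEmpty_or_nonempty X with hX | ⟨⟨x₀⟩⟩
  · exact funext fun x => (hX.false x).elim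
  have hcl : IsClosed {x | f x = h x} := isClosed_eq hf hh
  rcases eq_empty_or_univ_of_smul_invariant_closed G hcl (by
    rintro g _ ⟨x, hx, rfl⟩
    simp only [mem_ofPred_eq] at hx ⊢
    rw [hfe, hhe, hx]) with h0 | h1
  · exfalso
    let _ : MeasurableSpace Y := borel Y
    have : BorelSpace Y := ⟨rfl⟩
    let μ : Measure Y := (2⁻¹ : ENNReal) • (Measure.dirac (f x₀) + Measure.dirac (h x₀))
    have hμ : IsProbabilityMeasure μ := ⟨by
      simp only [μ, Measure.smul_apply, Measure.add_apply, measure_univ, smul_eq_mul]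
      rw [one_add_one_eq_two, ENNReal.inv_mul_cancel (by simp) (by simp)]⟩
    have key : ∀ S : Set Y, MeasurableSet S → (f x₀ ∈ S ∨ h x₀ ∈ S) → (1 / 2 : ℝ) ≤ μ.real S := by
      intro S hS hmem
      have : (2⁻¹ : ENNReal) ≤ μ S := by
        simp only [μ, Measure.smul_apply, Measure.add_apply, smul_eq_mul]
        calc (2⁻¹ : ENNReal) = 2⁻¹ * 1 := by simp
          _ ≤ _ := by
            gcongr
            rcases hmem with hm | hm
            · rw [Measure.dirac_apply_of_mem hm]; exact le_self_add
            · rw [Measure.dirac_apply_of_mem hm]; exact le_add_self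
      simpa [measureReal_def] using ENNReal.toReal_mono (measure_ne_top μ S) this
    obtain ⟨F, y, hy⟩ := isStronglyProximal_iff.1 hY.stronglyProximal _ ‹_› μ hμ
    -- Each of the two atoms has mass at least `1/2`, so a translate with less than `1/2` outside
    -- `O` carries both into `O`.
    have hdiag : (y, y) ∈ closure (range fun x => (f x, h x)) := by
      rw [mem_closure_iff_nhds]
      intro t ht
      obtain ⟨O, hO, hyO, hOt⟩ : ∃ O : Set Y, IsOpen O ∧ y ∈ O ∧ O ×ˢ O ⊆ t := by
        obtain ⟨A, hA, B, hB, hAB⟩ := mem_nhds_prod_iff.1 ht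
        obtain ⟨O, hO1, hO2, hO3⟩ := mem_nhds_iff.1 (inter_mem hA hB)
        exact ⟨O, hO2, hO3, (prod_mono (hO1.trans inter_subset_left)
          (hO1.trans inter_subset_right)).trans hAB⟩
      obtain ⟨g, hg⟩ := (hy O hO hyO (1 / 2) (by norm_num)).exists
      have hS : MeasurableSet {z : Y | g • z ∉ O} :=
        ((hO.preimage (continuous_const_smul g)).measurableSet).compl
      refine ⟨(f (g • x₀), h (g • x₀)), hOt ⟨?_, ?_⟩, g • x₀, rfl⟩
      · by_contra hc
        exact absurd (key _ hS (Or.inl (by simpa [hfe] using hc))) (not_le.2 hg)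
      · by_contra hc
        exact absurd (key _ hS (Or.inr (by simpa [hhe] using hc))) (not_le.2 hg)
    rw [(isCompact_range (hf.prodMk hh)).isClosed.closure_eq] at hdiag
    obtain ⟨x, hx⟩ := hdiag
    simp only [Prod.mk.injEq] at hx
    have : x ∈ {x | f x = h x} := hx.1.trans hx.2.symm
    rw [h0] at this
    exact this
  · funext x
    have : x ∈ {x | f x = h x} := h1 ▸ mem_univ x
    exact this

/-- An equivariant continuous map to a minimal flow from a nonempty flow is onto. -/
theorem surjective_of_equivariant [MulAction.IsMinimal G Y] [Nonempty X] {f : X → Y}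
    (hf : Continuous f) (hfe : ∀ (g : G) x, f (g • x) = g • f x) : Function.Surjective f := by
  rcases eq_empty_or_univ_of_smul_invariant_closed G (isCompact_range hf).isClosed (by
    rintro g _ ⟨_, ⟨x, rfl⟩, rfl⟩
    exact ⟨g • x, hfe g x⟩) with h0 | h1
  · exact absurd h0 (range_nonempty f).ne_empty
  · exact range_eq_univ.1 h1

/-- An irreducible extension of a boundary is a boundary. -/
theorem IsBoundary.of_irreducible (hX : IsBoundary G X) [Nonempty Y] {f : Y → X}
    (hf : Continuous f) (hfe : ∀ (g : G) y, f (g • y) = g • f y)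
    (hirr : ∀ O : Set Y, IsOpen O → O.Nonempty →
      ∃ W : Set X, IsOpen W ∧ W.Nonempty ∧ f ⁻¹' W ⊆ O) : IsBoundary G Y := by
  have := hX.minimal
  have hdense : ∀ (O : Set Y), IsOpen O → O.Nonempty → ∀ y : Y, ∃ g : G, g • y ∈ O := by
    intro O hO hne y
    obtain ⟨W, hW, hWne, hWO⟩ := hirr O hO hne
    obtain ⟨g, hg⟩ := hW.exists_smul_mem G (f y) hWne
    exact ⟨g, hWO (by simpa [hfe] using hg)⟩
  refine ⟨‹_›, ⟨fun y => ?_⟩, ?_⟩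
  · rw [dense_iff_inter_open]
    intro O hO hne
    obtain ⟨g, hg⟩ := hdense O hO hne y
    exact ⟨g • y, hg, g, rfl⟩
  · refine isStronglyProximal_iff.2 fun m hm μ hμ => ?_
    -- Any point serves as limit: each of its neighbourhoods contains the preimage of a nonempty
    -- open `W`, into which the image measure can be pushed.
    obtain ⟨y⟩ := ‹Nonempty Y›
    suffices h : ∃ F : Ultrafilter G, ConcentratesAt (F : Filter G) μ y from
      ⟨h.choose, y, h.choose_spec⟩
    refine exists_ultrafilter_concentratesAt fun O hO hyO ε hε => ?_
    obtain ⟨W, hW, hWne, hWO⟩ := hirr O hO ⟨y, hyO⟩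
    let _ : MeasurableSpace X := borel X
    have : BorelSpace X := ⟨rfl⟩
    have hμ' : IsProbabilityMeasure (μ.map f) :=
      Measure.isProbabilityMeasure_map hf.measurable.aemeasurable
    obtain ⟨g, hg⟩ := hX.exists_measure_lt (μ.map f) hW hWne hε
    have hS : MeasurableSet {z : X | g • z ∉ W} :=
      ((hW.preimage (continuous_const_smul g)).measurableSet).compl
    rw [map_measureReal_apply hf.measurable hS] at hg
    refine ⟨g, lt_of_le_of_lt (measureReal_mono ?_) hg⟩
    intro z hz
    simp only [mem_ofPred_eq, mem_preimage] at hz ⊢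
    exact fun hc => hz (hWO (by simpa [hfe] using hc))

end Boundary

/-! ### Existence of the Furstenberg boundary -/

section Joint

variable {G : Type*} [Group G] {X : Type*} [TopologicalSpace X] [CompactSpace X]
  [MulAction G X] [MeasurableSpace X]

/-- By compactness of `X`, failure to concentrate anywhere is witnessed by finitely many pairs `(O,
ε)` and hence by a single set of `F`, a condition open in the ultrafilter. -/
theorem isClosed_setOf_concentratesAt (μ : Measure X) :
    IsClosed {F : Ultrafilter G | ∃ x, ConcentratesAt (F : Filter G) μ x} := by
  rw [← isOpen_compl_iff, isOpen_iff_mem_nhds]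
  intro F hF
  simp only [mem_compl_iff, mem_ofPred_eq, not_exists, ConcentratesAt, not_forall] at hF
  choose O hO hxO ε hε h using hF
  obtain ⟨T, hT⟩ := isCompact_univ.elim_finite_subcover O hO
    (fun x _ => mem_iUnion.2 ⟨x, hxO x⟩)
  let S : Set G := {g | ∀ x ∈ T, ¬ μ.real {y : X | g • y ∉ O x} < ε x}
  have hS : S ∈ F := by
    have : ∀ᶠ g in (F : Filter G), ∀ x ∈ T, ¬ μ.real {y : X | g • y ∉ O x} < ε x :=
      (Finset.eventually_all T).2 fun x _ => Ultrafilter.eventually_not.2 (h x)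
    exact this
  refine mem_of_superset ((ultrafilter_isOpen_basic S).mem_nhds hS) ?_
  rintro F' hF' ⟨x, hx⟩
  obtain ⟨k, hk, hxk⟩ := mem_iUnion₂.1 (hT (mem_univ x))
  obtain ⟨g, hg1, hg2⟩ := ((hx (O k) (hO k) hxk (ε k) (hε k)).and
    (show ∀ᶠ g in (F' : Filter G), g ∈ S from hF')).exists
  exact hg2 k hk hg1

attribute [local instance] Ultrafilter.mul

variable [TopologicalSpace G] [T2Space X] [ContinuousSMul G X] [BorelSpace X]

/-- Left multiplication by `H` preserves concentration: the limit point moves to the limit of `k •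
x` along `H`. The conclusion unfolds concentration along `H * F`. -/
theorem ConcentratesAt.exists_mul_left {F : Filter G} {μ : Measure X} {x : X}
    (h : ConcentratesAt F μ x) (H : Ultrafilter G) : ∃ x' : X,
    ∀ O : Set X, IsOpen O → x' ∈ O → ∀ ε : ℝ, 0 < ε →
      ∀ᶠ k in (H : Filter G), ∀ᶠ g in F, μ.real {y : X | (k * g) • y ∉ O} < ε := by
  obtain ⟨x', -, hx'⟩ := isCompact_univ.ultrafilter_le_nhds (H.map fun k => k • x) (by simp)
  refine ⟨x', fun O hO hxO ε hε => ?_⟩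
  have h1 : ∀ᶠ k in (H : Filter G), k • x ∈ O := hx' (hO.mem_nhds hxO)
  filter_upwards [h1] with k hk
  filter_upwards [h _ (hO.preimage (continuous_const_smul k)) hk ε hε] with g hg
  simpa [mul_smul] using hg

/-- First pass to a limit `ν` of `μ` along `F`, then let `H` contract `ν`. -/
theorem IsStronglyProximal.exists_mul_left (hX : IsStronglyProximal G X) (F : Ultrafilter G)
    (μ : Measure X) [IsProbabilityMeasure μ] : ∃ (H : Ultrafilter G) (x : X),
    ConcentratesAt ((H * F : Ultrafilter G) : Filter G) μ x := by
  obtain ⟨ν, hν, hlim⟩ := exists_limit_measure F μ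
  obtain ⟨H, x, hx⟩ := isStronglyProximal_iff.1 hX _ ‹_› ν hν
  refine ⟨H, x, fun O hO hxO ε hε => ?_⟩
  rw [Ultrafilter.eventually_mul]
  filter_upwards [hx O hO hxO ε hε] with k hk
  filter_upwards [hlim {y : X | k • y ∉ O}
    (hO.preimage (continuous_const_smul k)).isClosed_compl ε hk] with g hg
  simpa [mul_smul] using hg

end Joint

/-! ### Simultaneous contraction of measures -/

section JointFamily

attribute [local instance] Ultrafilter.mul

variable {G : Type*} [Group G] [TopologicalSpace G] {ι : Type*} {Y : ι → Type*}
  [∀ i, TopologicalSpace (Y i)] [∀ i, CompactSpace (Y i)] [∀ i, T2Space (Y i)]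
  [∀ i, MulAction G (Y i)] [∀ i, ContinuousSMul G (Y i)]
  [∀ i, MeasurableSpace (Y i)] [∀ i, BorelSpace (Y i)]

/-- Probability measures on strongly proximal flows can be simultaneously contracted to points. -/
theorem exists_forall_concentratesAt (hY : ∀ i, IsStronglyProximal G (Y i))
    (μ : ∀ i, Measure (Y i)) [∀ i, IsProbabilityMeasure (μ i)] :
    ∃ F : Ultrafilter G, ∀ i, ∃ x, ConcentratesAt (F : Filter G) (μ i) x := by
  have hfin : ∀ S : Finset ι, ∃ F : Ultrafilter G, ∀ i ∈ S, ∃ x,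
      ConcentratesAt (F : Filter G) (μ i) x := by
    classical
    intro S
    induction S using Finset.induction_on with
    | empty => exact ⟨pure 1, by simp⟩
    | insert j S _ ih =>
      obtain ⟨F, hF⟩ := ih
      -- Multiplying on the left contracts the new measure without spoiling the earlier ones.
      obtain ⟨H, x, hx⟩ := (hY j).exists_mul_left F (μ j)
      refine ⟨H * F, fun i hi => ?_⟩
      rcases Finset.mem_insert.1 hi with rfl | hi
      · exact ⟨x, hx⟩
      · obtain ⟨y, hy⟩ := hF i hi
        exact hy.exists_mul_left H
  obtain ⟨F, hF⟩ := CompactSpace.iInter_nonempty (X := Ultrafilter G)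
    (fun i => isClosed_setOf_concentratesAt (G := G) (μ i)) (fun S => by
      obtain ⟨F, hF⟩ := hfin S
      exact ⟨F, mem_iInter₂.2 hF⟩)
  exact ⟨F, mem_iInter.1 hF⟩

end JointFamily

/-! ### Minimal subflows and the product boundary -/

section Minimal

variable (G : Type*) [Group G] (X : Type*) [TopologicalSpace X] [CompactSpace X] [Nonempty X]
  [MulAction G X] [ContinuousConstSMul G X]

theorem exists_minimal_closed_invariant : ∃ Z : Set X, IsClosed Z ∧ Z.Nonempty ∧
    (∀ (g : G), ∀ z ∈ Z, g • z ∈ Z) ∧ ∀ z ∈ Z, Z ⊆ closure (MulAction.orbit G z) := by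
  let S : Set (Set X) := {Z | IsClosed Z ∧ Z.Nonempty ∧ ∀ (g : G), ∀ z ∈ Z, g • z ∈ Z}
  obtain ⟨Z, hZ⟩ := zorn_superset S (by
    intro c hc hchain
    rcases c.eq_empty_or_nonempty with rfl | hne
    · exact ⟨univ, ⟨isClosed_univ, univ_nonempty, fun _ _ _ => mem_univ _⟩, by simp⟩
    · refine ⟨⋂₀ c, ⟨isClosed_sInter fun t ht => (hc ht).1, ?_, fun g z hz t ht =>
        (hc ht).2.2 g z (hz t ht)⟩, fun t ht => sInter_subset_of_mem ht⟩
      have := hne.to_subtype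
      exact IsCompact.nonempty_sInter_of_directed_nonempty_isCompact_isClosed
        (fun a ha b hb => (hchain.total ha hb).elim (fun h => ⟨a, ha, subset_rfl, h⟩)
          fun h => ⟨b, hb, h, subset_rfl⟩) (fun t ht => (hc ht).2.1)
        (fun t ht => (hc ht).1.isCompact) (fun t ht => (hc ht).1))
  refine ⟨Z, hZ.prop.1, hZ.prop.2.1, hZ.prop.2.2, fun z hz => ?_⟩
  refine hZ.le_of_le (y := closure (MulAction.orbit G z))
    ⟨isClosed_closure, (MulAction.nonempty_orbit z).closure, fun g y hy => ?_⟩ ?_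
  · exact smul_closure_orbit_subset g z (smul_mem_smul_set hy)
  · refine closure_minimal ?_ hZ.prop.1
    rintro _ ⟨g, rfl⟩
    exact hZ.prop.2.2 g z hz

end Minimal

/-- A minimal compact flow is an image of the space of ultrafilters on the group. -/
theorem small_of_isMinimal {G : Type u} [Group G] (X : Type v) [TopologicalSpace X]
    [CompactSpace X] [T2Space X] [MulAction G X] [MulAction.IsMinimal G X] : Small.{u} X := by
  rcases isEmpty_or_nonempty X with hX | ⟨⟨x⟩⟩
  · infer_instance
  · let e : Ultrafilter G → X := Ultrafilter.extend fun g : G => g • x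
    have he : Continuous e := continuous_ultrafilter_extend _
    refine small_of_surjective (f := e) (range_eq_univ.1 ?_)
    rw [← (isCompact_range he).isClosed.closure_eq, ← dense_iff_closure_eq]
    refine (denseRange_smul G x).mono ?_
    rintro _ ⟨g, rfl⟩
    exact ⟨pure g, ultrafilter_extend_pure _ g⟩

/-- A bundled boundary of `G` in the universe of `G`. -/
structure BoundaryFlow (G : Type u) [Group G] [TopologicalSpace G] where
  carrier : Type u
  [topologicalSpace : TopologicalSpace carrier]
  [compactSpace : CompactSpace carrier]
  [t2Space : T2Space carrier]
  [mulAction : MulAction G carrier]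
  [continuousSMul : ContinuousSMul G carrier]
  isBoundary : IsBoundary G carrier

attribute [instance] BoundaryFlow.topologicalSpace BoundaryFlow.compactSpace
  BoundaryFlow.t2Space BoundaryFlow.mulAction BoundaryFlow.continuousSMul

/-- Every family of boundaries has a common extension which is a boundary: a minimal closed
invariant subset of the product. -/
theorem exists_boundary_of_family {G : Type u} [Group G] [TopologicalSpace G] {ι : Type v}
    (Y : ι → Type w)
    [∀ i, TopologicalSpace (Y i)] [∀ i, CompactSpace (Y i)] [∀ i, T2Space (Y i)]
    [∀ i, MulAction G (Y i)] [∀ i, ContinuousSMul G (Y i)] (hY : ∀ i, IsBoundary G (Y i)) :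
    ∃ (X : Type (max v w)) (_ : TopologicalSpace X) (_ : CompactSpace X) (_ : T2Space X)
      (_ : MulAction G X) (_ : ContinuousSMul G X), IsBoundary G X ∧
      ∀ i, ∃ f : X → Y i, Continuous f ∧ ∀ (g : G) x, f (g • x) = g • f x := by
  have hne : ∀ i, Nonempty (Y i) := fun i => (hY i).nonempty
  have : ContinuousSMul G (∀ i, Y i) := inferInstance
  obtain ⟨Z, hZc, hZne, hZinv, hZmin⟩ := exists_minimal_closed_invariant G (∀ i, Y i)
  have hZcomp : CompactSpace Z := isCompact_iff_compactSpace.1 hZc.isCompact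
  let act : MulAction G Z :=
    { smul := fun g z => ⟨g • z.1, hZinv g z.1 z.2⟩
      one_smul := fun z => Subtype.ext (one_smul G z.1)
      mul_smul := fun g h z => Subtype.ext (mul_smul g h z.1) }
  have hcs : ContinuousSMul G Z :=
    ⟨(continuous_fst.smul (continuous_subtype_val.comp continuous_snd)).subtype_mk _⟩
  have hmin : MulAction.IsMinimal G Z := by
    refine ⟨fun z => ?_⟩
    intro z'
    rw [closure_subtype]
    have : ((↑) : Z → ∀ i, Y i) '' MulAction.orbit G z = MulAction.orbit G z.1 := by
      ext x
      constructor
      · rintro ⟨_, ⟨g, rfl⟩, rfl⟩; exact ⟨g, rfl⟩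
      · rintro ⟨g, rfl⟩; exact ⟨g • z, ⟨g, rfl⟩, rfl⟩
    rw [this]
    exact hZmin z.1 z.2 z'.2
  let p : ∀ i, Z → Y i := fun i z => z.1 i
  have hp : ∀ i, Continuous (p i) := fun i => (continuous_apply i).comp continuous_subtype_val
  have hpe : ∀ i (g : G) z, p i (g • z) = g • p i z := fun i g z => rfl
  refine ⟨Z, inferInstance, hZcomp, inferInstance, act, hcs, ⟨hZne.to_subtype, hmin, ?_⟩,
    fun i => ⟨p i, hp i, hpe i⟩⟩
  refine isStronglyProximal_iff.2 fun m hm μ hμ => ?_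
  let _ : ∀ i, MeasurableSpace (Y i) := fun i => borel (Y i)
  have : ∀ i, BorelSpace (Y i) := fun i => ⟨rfl⟩
  have : ∀ i, IsProbabilityMeasure (μ.map (p i)) := fun i =>
    Measure.isProbabilityMeasure_map (hp i).measurable.aemeasurable
  obtain ⟨F, hF⟩ := exists_forall_concentratesAt (fun i => (hY i).stronglyProximal)
    (fun i => μ.map (p i))
  choose x hx using hF
  have key : ∀ (T : Finset ι) (O : ∀ i, Set (Y i)), (∀ i ∈ T, IsOpen (O i) ∧ x i ∈ O i) →
      ∀ ε : ℝ, 0 < ε → ∀ᶠ g in (F : Filter G), μ.real {z : Z | ¬ ∀ i ∈ T, (g • z).1 i ∈ O i} < ε := by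
    intro T O hO ε hε
    -- The summand `1` keeps the divisor positive when `T` is empty and makes the union bound
    -- strict.
    have h1 : ∀ᶠ g in (F : Filter G), ∀ i ∈ T,
        (μ.map (p i)).real {y : Y i | g • y ∉ O i} < ε / (T.card + 1) :=
      (Finset.eventually_all T).2 fun i hi =>
        hx i (O i) (hO i hi).1 (hO i hi).2 _ (by positivity)
    filter_upwards [h1] with g hg
    have h2 : {z : Z | ¬ ∀ i ∈ T, (g • z).1 i ∈ O i} ⊆
        ⋃ i ∈ T, p i ⁻¹' {y : Y i | g • y ∉ O i} := by
      intro z hz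
      simp only [mem_ofPred_eq, not_forall] at hz
      obtain ⟨i, hi, hz⟩ := hz
      exact mem_iUnion₂.2 ⟨i, hi, hz⟩
    calc μ.real _ ≤ μ.real (⋃ i ∈ T, p i ⁻¹' {y : Y i | g • y ∉ O i}) :=
          measureReal_mono h2 (measure_ne_top _ _)
      _ ≤ ∑ i ∈ T, μ.real (p i ⁻¹' {y : Y i | g • y ∉ O i}) := measureReal_biUnion_finset_le _ _
      _ ≤ ∑ i ∈ T, ε / (T.card + 1) := by
          refine Finset.sum_le_sum fun i hi => ?_
          have hS : MeasurableSet {y : Y i | g • y ∉ O i} :=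
            (((hO i hi).1.preimage (continuous_const_smul g)).measurableSet).compl
          rw [← map_measureReal_apply (hp i).measurable hS]
          exact (hg i hi).le
      _ = T.card * (ε / (T.card + 1)) := by simp
      _ < ε := by
          rw [mul_div_assoc', div_lt_iff₀ (by positivity)]
          nlinarith
  have basic : ∀ O : Set (∀ i, Y i), IsOpen O → x ∈ O → ∀ ε : ℝ, 0 < ε →
      ∀ᶠ g in (F : Filter G), μ.real {z : Z | (g • z).1 ∉ O} < ε := by
    intro O hO hxO ε hε
    obtain ⟨T, u, hu, hsub⟩ := isOpen_pi_iff.1 hO x hxO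
    filter_upwards [key T u hu ε hε] with g hg
    refine lt_of_le_of_lt (measureReal_mono ?_) hg
    intro z hz h
    exact hz (hsub fun i hi => h i hi)
  -- Otherwise `Zᶜ` is a neighbourhood of `x` that misses all the mass.
  have hxZ : x ∈ Z := by
    by_contra hxZ
    obtain ⟨g, hg⟩ := (basic Zᶜ hZc.isOpen_compl hxZ 1 one_pos).exists
    have : {z : Z | (g • z).1 ∉ Zᶜ} = univ := eq_univ_of_forall fun z => by
      simp
    rw [this] at hg
    simp at hg
  refine ⟨F, ⟨x, hxZ⟩, fun O hO hxO ε hε => ?_⟩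
  obtain ⟨O', hO', rfl⟩ := isOpen_induced_iff.1 hO
  exact basic O' hO' hxO ε hε

theorem exists_isFurstenbergBoundary (G : Type u) [Group G] [TopologicalSpace G] :
    ∃ (X : Type u) (_ : TopologicalSpace X) (_ : CompactSpace X) (_ : T2Space X)
      (_ : MulAction G X) (_ : ContinuousSMul G X), IsFurstenbergBoundary G X := by
  obtain ⟨Z, _, _, _, _, _, hZ, hf⟩ := exists_boundary_of_family
    (fun B : BoundaryFlow G => B.carrier) (fun B => B.isBoundary)
  have := hZ.minimal
  have := hZ.nonempty
  -- The product is indexed by all boundaries in universe `u`, so `Z` lives one universe higher;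
  -- minimality allows a copy in `u`.
  obtain ⟨S, ⟨e₀⟩⟩ := (small_of_isMinimal (G := G) Z).equiv_small
  let _ : TopologicalSpace S := e₀.symm.topologicalSpace
  let e : Z ≃ₜ S := e₀.symm.homeomorph.symm
  have : CompactSpace S := e.compactSpace
  have : T2Space S := e.symm.isEmbedding.t2Space
  have : Nonempty S := e.symm.toEquiv.nonempty
  let act : MulAction G S := e.symm.toEquiv.mulAction G
  have hes : ∀ (g : G) x, e.symm (g • x) = g • e.symm x := fun g x => e.symm_apply_apply _
  have : ContinuousSMul G S :=
    ⟨e.continuous.comp (continuous_fst.smul (e.symm.continuous.comp continuous_snd))⟩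
  have hB : IsBoundary G S := by
    refine hZ.of_irreducible e.symm.continuous hes fun O hO hne =>
      ⟨e.symm '' O, e.symm.isOpenMap O hO, hne.image _, ?_⟩
    rw [e.symm.injective.preimage_image]
  refine ⟨S, inferInstance, ‹_›, ‹_›, act, ‹_›, hB, ?_⟩
  intro Y _ _ _ _ _ hY
  obtain ⟨f, hfc, hfe⟩ := hf ⟨Y, hY⟩
  have := hY.minimal
  have hc : Continuous (f ∘ e.symm) := hfc.comp e.symm.continuous
  have he : ∀ (g : G) x, (f ∘ e.symm) (g • x) = g • (f ∘ e.symm) x := fun g x => by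
    simp only [Function.comp, hes, hfe]
  exact ⟨⟨f ∘ e.symm, he⟩, hc, surjective_of_equivariant hc he⟩

/-! ### Irreducible extensions making a semicontinuous function continuous -/

section EssentialGraph

variable {X : Type*} [TopologicalSpace X] {E : Type*} [TopologicalSpace E]

/-- The essential graph of a (discontinuous) map `θ`: the points all of whose neighbourhoods
contain a non-meagre part of the graph. -/
def essentialGraph (θ : X → E) : Set (X × E) :=
  {p | ∀ O ∈ 𝓝 p, ¬ IsMeagre {x : X | (x, θ x) ∈ O}}

theorem isClosed_essentialGraph (θ : X → E) : IsClosed (essentialGraph θ) := by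
  refine isClosed_of_closure_subset fun p hp O hO => ?_
  obtain ⟨q, hqO, hq⟩ := mem_closure_iff.1 hp (interior O) isOpen_interior
    (mem_interior_iff_mem_nhds.2 hO)
  exact hq O (mem_interior_iff_mem_nhds.1 hqO)

theorem exists_graph_mem_of_mem_essentialGraph {θ : X → E} {p : X × E}
    (hp : p ∈ essentialGraph θ) {O : Set (X × E)} (hO : O ∈ 𝓝 p) : ∃ x, (x, θ x) ∈ O :=
  nonempty_of_not_isMeagre (hp O hO)

/-- If the fibre over `x` were empty, finitely many boxes with meagre trace on the graph would cover
it by compactness of `E`, and a neighbourhood of `x` would be meagre. -/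
theorem exists_mem_essentialGraph [BaireSpace X] [CompactSpace E] (θ : X → E) (x : X) :
    ∃ e, (x, e) ∈ essentialGraph θ := by
  by_contra! h
  have h' : ∀ e : E, ∃ A ∈ 𝓝 x, ∃ B ∈ 𝓝 e, IsMeagre {y : X | y ∈ A ∧ θ y ∈ B} := by
    intro e
    have he := h e
    simp only [essentialGraph, mem_ofPred_eq, not_forall, not_not] at he
    obtain ⟨O, hO, hm⟩ := he
    obtain ⟨A, hA, B, hB, hAB⟩ := mem_nhds_prod_iff.1 hO
    exact ⟨A, hA, B, hB, hm.mono fun y hy => hAB ⟨hy.1, hy.2⟩⟩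
  choose A hA B hB hm using h'
  obtain ⟨T, hT⟩ := CompactSpace.elim_nhds_subcover B hB
  have hN : (⋂ e ∈ T, A e) ∈ 𝓝 x := (biInter_finset_mem T).2 fun e _ => hA e
  refine not_isMeagre_of_isOpen isOpen_interior ⟨x, mem_interior_iff_mem_nhds.2 hN⟩ ?_
  refine (isMeagre_biUnion T.countable_toSet fun e _ => hm e).mono fun y hy => ?_
  have hy' : y ∈ ⋂ e ∈ T, A e := interior_subset hy
  have hθ : θ y ∈ ⋃ e ∈ T, B e := hT ▸ mem_univ (θ y)
  obtain ⟨e, he, hye⟩ := mem_iUnion₂.1 hθ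
  exact mem_iUnion₂.2 ⟨e, he, mem_iInter₂.1 hy' e he, hye⟩

/-- Semicontinuity splits closeness of `θ` to `a` into an open condition `P` and a closed condition
`Q`. A non-meagre `P ∩ Q` is dense in some open set, where `Q` then holds throughout, so all of the
essential graph over a smaller open set is close to `p`. -/
theorem essentialGraph_irreducible {ι : Type*} {θ : X → ι → unitInterval}
    (hθ : ∀ i, LowerSemicontinuous fun x => (θ x i : ℝ)) {p : X × (ι → unitInterval)}
    (hp : p ∈ essentialGraph θ) {O : Set (X × (ι → unitInterval))} (hO : O ∈ 𝓝 p) :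
    ∃ W : Set X, IsOpen W ∧ W.Nonempty ∧ ∀ q ∈ essentialGraph θ, q.1 ∈ W → q ∈ O := by
  obtain ⟨x, a⟩ := p
  obtain ⟨N', hN', B, hB, hNB⟩ := mem_nhds_prod_iff.1 hO
  obtain ⟨N, hN, hNo, hxN⟩ := mem_nhds_iff.1 hN'
  obtain ⟨B', hB', hB'o, haB⟩ := mem_nhds_iff.1 hB
  obtain ⟨T, V, hV, hVB⟩ := isOpen_pi_iff.1 hB'o a haB
  have hε : ∀ i, ∃ ε : ℝ, 0 < ε ∧ (i ∈ T → Metric.ball (a i) ε ⊆ V i) := by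
    intro i
    by_cases hi : i ∈ T
    · obtain ⟨ε, hε, h⟩ := Metric.isOpen_iff.1 (hV i hi).1 (a i) (hV i hi).2
      exact ⟨ε, hε, fun _ => h⟩
    · exact ⟨1, one_pos, fun h => absurd h hi⟩
  choose ε hε hεV using hε
  let P : Set X := N ∩ ⋂ i ∈ T, {y | (a i : ℝ) - ε i / 2 < θ y i}
  let Q : Set X := ⋂ i ∈ T, {y | (θ y i : ℝ) ≤ a i + ε i / 2}
  have hP : IsOpen P := hNo.inter (isOpen_biInter_finset fun i _ =>
    (hθ i).isOpen_preimage _)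
  have hQ : IsClosed Q := isClosed_biInter fun i _ => (hθ i).isClosed_preimage _
  have hnm : ¬ IsMeagre (P ∩ Q) := by
    have hU : N ×ˢ {v : ι → unitInterval | ∀ i ∈ T, dist (v i) (a i) < ε i / 2} ∈ 𝓝 (x, a) := by
      refine prod_mem_nhds (hNo.mem_nhds hxN) ?_
      have : ∀ i ∈ T, ∀ᶠ v : ι → unitInterval in 𝓝 a, dist (v i) (a i) < ε i / 2 := fun i _ =>
        ((continuous_apply i).tendsto a).eventually (Metric.ball_mem_nhds (a i) (half_pos (hε i)))
      exact (Finset.eventually_all T).2 this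
    refine fun hm => hp _ hU (hm.mono fun y hy => ?_)
    obtain ⟨hy1, hy2⟩ := hy
    have hy3 : ∀ i ∈ T, |(θ y i : ℝ) - a i| < ε i / 2 := hy2
    refine ⟨⟨hy1, mem_iInter₂.2 fun i hi => ?_⟩, mem_iInter₂.2 fun i hi => ?_⟩
    · have := (abs_lt.1 (hy3 i hi)).1
      simp only [mem_ofPred_eq]; linarith
    · have := (abs_lt.1 (hy3 i hi)).2
      simp only [mem_ofPred_eq]; linarith
  have hne : (interior (closure (P ∩ Q))).Nonempty := by
    rw [nonempty_iff_ne_empty]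
    exact fun h => hnm (IsNowhereDense.isMeagre h)
  refine ⟨interior (closure (P ∩ Q)) ∩ P, isOpen_interior.inter hP, ?_, ?_⟩
  · obtain ⟨y, hy⟩ := hne
    obtain ⟨z, hz, hzPQ⟩ := mem_closure_iff.1 (interior_subset hy) _ isOpen_interior hy
    exact ⟨z, hz, hzPQ.1⟩
  · rintro ⟨x', b⟩ hq hxW
    have hclQ : closure (P ∩ Q) ⊆ Q := closure_minimal inter_subset_right hQ
    refine hNB ⟨hN hxW.2.1, hB' (hVB fun i hi => hεV i hi ?_)⟩
    rw [Metric.mem_ball]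
    refine lt_of_le_of_lt ?_ (half_lt_self (hε i))
    by_contra! hlt
    have hU : (interior (closure (P ∩ Q)) ∩ P) ×ˢ
        {v : ι → unitInterval | ε i / 2 < dist (v i) (a i)} ∈ 𝓝 (x', b) :=
      prod_mem_nhds ((isOpen_interior.inter hP).mem_nhds hxW)
        ((isOpen_lt continuous_const ((continuous_apply i).dist continuous_const)).mem_nhds hlt)
    obtain ⟨y, hy, hyd⟩ := exists_graph_mem_of_mem_essentialGraph hq hU
    have h1 : (a i : ℝ) - ε i / 2 < θ y i := mem_iInter₂.1 hy.2.2 i hi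
    have h2 : (θ y i : ℝ) ≤ a i + ε i / 2 := mem_iInter₂.1 (hclQ (interior_subset hy.1)) i hi
    have h3 : ε i / 2 < |(θ y i : ℝ) - a i| := hyd
    exact absurd h3 (not_lt.2 (abs_le.2 ⟨by linarith, by linarith⟩))

end EssentialGraph

/-! ### Sections of irreducible extensions -/

section Extension

/-- On the Furstenberg boundary, semicontinuous functions that are uniformly continuous along the
action are continuous up to modification. -/
theorem IsFurstenbergBoundary.exists_continuous_modification {G : Type u} [Group G]
    [TopologicalSpace G] [IsTopologicalGroup G] {X : Type u} [TopologicalSpace X] [CompactSpace X]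
    [T2Space X] [MulAction G X] [ContinuousSMul G X] (hX : IsFurstenbergBoundary G X)
    {f : X → unitInterval} (hf : LowerSemicontinuous fun x => (f x : ℝ))
    (hfG : ∀ ε : ℝ, 0 < ε → ∀ᶠ k : G in 𝓝 1, ∀ x, dist (f (k • x)) (f x) ≤ ε) :
    ∃ f' : X → unitInterval, Continuous f' ∧ ∀ x c, (∀ᶠ y in 𝓝 x, f y = c) → f' x = c := by
  -- Recording all translates of `f` at once makes the essential graph invariant under `tr`, which
  -- acts on the second factor by shifting coordinates.
  let θ : X → G → unitInterval := fun x g => f (g • x)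
  have hθ : ∀ g : G, LowerSemicontinuous fun x => (θ x g : ℝ) := fun g =>
    hf.comp (continuous_const_smul g)
  let Z := essentialGraph θ
  have hZ : CompactSpace Z :=
    isCompact_iff_compactSpace.1 (isClosed_essentialGraph θ).isCompact
  let tr : G → X × (G → unitInterval) → X × (G → unitInterval) := fun h p =>
    (h • p.1, fun g => p.2 (g * h))
  have htr : ∀ h, Continuous (tr h) := fun h =>
    ((continuous_const_smul h).comp continuous_fst).prodMk
      (continuous_pi fun g => (continuous_apply (g * h)).comp continuous_snd)
  have hinv : ∀ h, ∀ p ∈ Z, tr h p ∈ Z := by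
    intro h p hp O hO hm
    refine hp _ ((htr h).continuousAt hO) ?_
    have := hm.preimage_of_isOpenMap (continuous_const_smul h) (isOpenMap_smul h)
    refine this.mono fun y hy => ?_
    simpa [tr, θ, mul_smul] using hy
  let act : MulAction G Z :=
    { smul := fun g z => ⟨tr g z.1, hinv g z.1 z.2⟩
      one_smul := fun z => Subtype.ext (by
        change tr 1 z.1 = z.1
        simp [tr])
      mul_smul := fun g h z => Subtype.ext (by
        change tr (g * h) z.1 = tr g (tr h z.1)
        simp [tr, mul_smul, mul_assoc]) }
  -- Coordinate shifts need not be jointly continuous on the full product; this equicontinuity,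
  -- inherited from `hfG`, makes them so on `Z`.
  have hequi : ∀ ε : ℝ, 0 < ε → ∀ᶠ k : G in 𝓝 1, ∀ z : Z, ∀ g : G,
      dist (z.1.2 (k * g)) (z.1.2 g) ≤ ε := by
    intro ε hε
    filter_upwards [hfG ε hε] with k hk z g
    by_contra! hlt
    have hU : {p : X × (G → unitInterval) | ε < dist (p.2 (k * g)) (p.2 g)} ∈ 𝓝 z.1 :=
      (isOpen_lt continuous_const (((continuous_apply _).comp continuous_snd).dist
        ((continuous_apply _).comp continuous_snd))).mem_nhds hlt
    obtain ⟨y, hy⟩ := exists_graph_mem_of_mem_essentialGraph z.2 hU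
    have := hk (g • y)
    simp only [θ, mem_ofPred_eq, mul_smul] at hy
    exact absurd hy (not_lt.2 this)
  have hcs : ContinuousSMul G Z := by
    refine ⟨Continuous.subtype_mk (Continuous.prodMk (continuous_fst.smul
      (continuous_fst.comp (continuous_subtype_val.comp continuous_snd)))
      (continuous_pi fun g => ?_)) _⟩
    rw [continuous_iff_continuousAt]
    rintro ⟨h₀, z₀⟩
    rw [Metric.continuousAt_iff']
    intro ε hε
    have h1 : ∀ᶠ q : G × Z in 𝓝 (h₀, z₀), ∀ z : Z, ∀ g' : G,
        dist (z.1.2 ((g * q.1 * h₀⁻¹ * g⁻¹) * g')) (z.1.2 g') ≤ ε / 2 := by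
      have ht : Tendsto (fun q : G × Z => g * q.1 * h₀⁻¹ * g⁻¹) (𝓝 (h₀, z₀)) (𝓝 1) := by
        have : Continuous fun q : G × Z => g * q.1 * h₀⁻¹ * g⁻¹ := by fun_prop
        simpa using this.tendsto (h₀, z₀)
      exact ht.eventually (hequi (ε / 2) (half_pos hε))
    have h2 : ∀ᶠ q : G × Z in 𝓝 (h₀, z₀), dist (q.2.1.2 (g * h₀)) (z₀.1.2 (g * h₀)) < ε / 2 := by
      have : Continuous fun q : G × Z => q.2.1.2 (g * h₀) :=
        (continuous_apply (g * h₀)).comp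
          (continuous_snd.comp (continuous_subtype_val.comp continuous_snd))
      exact this.continuousAt.eventually (Metric.ball_mem_nhds _ (half_pos hε))
    filter_upwards [h1, h2] with q hq1 hq2
    have h3 := hq1 q.2 (g * h₀)
    have h4 : g * q.1 * h₀⁻¹ * g⁻¹ * (g * h₀) = g * q.1 := by group
    rw [h4] at h3
    calc dist (q.2.1.2 (g * q.1)) (z₀.1.2 (g * h₀))
        ≤ dist (q.2.1.2 (g * q.1)) (q.2.1.2 (g * h₀)) +
          dist (q.2.1.2 (g * h₀)) (z₀.1.2 (g * h₀)) := dist_triangle _ _ _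
      _ < ε := by linarith
  let π : Z → X := fun z => z.1.1
  have hπ : Continuous π := continuous_fst.comp continuous_subtype_val
  have hπe : ∀ (g : G) z, π (g • z) = g • π z := fun g z => rfl
  have hne : Nonempty Z := by
    obtain ⟨x⟩ := hX.isBoundary.nonempty
    obtain ⟨e, he⟩ := exists_mem_essentialGraph θ x
    exact ⟨⟨(x, e), he⟩⟩
  have hZB : IsBoundary G Z := by
    refine hX.isBoundary.of_irreducible hπ hπe ?_
    rintro O hO ⟨z, hz⟩
    obtain ⟨O', hO', rfl⟩ := isOpen_induced_iff.1 hO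
    obtain ⟨W, hW, hWne, hWO⟩ := essentialGraph_irreducible hθ z.2 (hO'.mem_nhds hz)
    exact ⟨W, hW, hWne, fun z' hz' => hWO z'.1 z'.2 hz'⟩
  obtain ⟨s, hs, -⟩ := hX.isFactor_of_isBoundary Z hZB
  have := hX.isBoundary.minimal
  -- The identity is the only equivariant continuous self-map of the boundary, so `s` is a section
  -- and its coordinate at `1` is the modification.
  have hsec : π ∘ s = id := hX.isBoundary.eq_of_equivariant (hπ.comp hs) continuous_id
    (fun g x => by simp only [Function.comp, map_smul, hπe]) (fun g x => rfl)
  refine ⟨fun x => (s x).1.2 1, (continuous_apply 1).comp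
    (continuous_snd.comp (continuous_subtype_val.comp hs)), fun x c hc => ?_⟩
  have hx : (s x).1.1 = x := congrFun hsec x
  by_contra hne
  have hU : {y | f y = c} ×ˢ {v : G → unitInterval | v 1 ≠ c} ∈ 𝓝 (s x).1 := by
    refine prod_mem_nhds (by rw [hx]; exact hc) ?_
    exact (isOpen_ne_fun (continuous_apply (1 : G)) continuous_const).mem_nhds hne
  obtain ⟨y, hy1, hy2⟩ := exists_graph_mem_of_mem_essentialGraph (s x).2 hU
  simp only [θ, mem_ofPred_eq, one_smul] at hy1 hy2
  exact hy2 hy1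

end Extension

/-! ### Separation of open sets in the Furstenberg boundary -/

open scoped Pointwise

theorem exists_bump_uniformContinuous {G : Type*} [Group G] [TopologicalSpace G]
    [IsTopologicalGroup G] [LocallyCompactSpace G] {V : Set G} (hV : V ∈ 𝓝 (1 : G)) :
    ∃ φ : G → ℝ, φ 1 = 1 ∧ (∀ g, φ g ∈ Icc (0 : ℝ) 1) ∧ (∀ g ∉ V, φ g = 0) ∧
      ∀ ε : ℝ, 0 < ε → ∀ᶠ k : G in 𝓝 1, ∀ g, |φ (k * g) - φ g| < ε := by
  obtain ⟨φ, hφ1, hφ0, hφc, hφ⟩ := exists_continuous_one_zero_of_isCompact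
    (isCompact_singleton (x := (1 : G))) (isOpen_interior (s := V)).isClosed_compl
    (disjoint_compl_right_iff_subset.2 (singleton_subset_iff.2 (mem_interior_iff_mem_nhds.2 hV)))
  refine ⟨φ, hφ1 rfl, hφ, fun g hg => hφ0 fun h => hg (interior_subset h), fun ε hε => ?_⟩
  have h1 : ∀ᶠ k : G in 𝓝 1, ∀ g ∈ tsupport φ, |φ (k * g) - φ g| < ε := by
    refine IsCompact.eventually_forall_of_forall_eventually hφc fun g _ => ?_
    have : Continuous fun z : G × G => |φ (z.1 * z.2) - φ z.2| := by fun_prop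
    exact (this.tendsto (1, g)).eventually_lt_const (by simpa using hε)
  -- Needed when `g` is outside the support but `k * g` is inside.
  have h2 : ∀ᶠ k : G in 𝓝 1, ∀ g ∈ tsupport φ, |φ (k⁻¹ * g) - φ g| < ε := by
    have ht : Tendsto (fun k : G => k⁻¹) (𝓝 1) (𝓝 1) := by
      simpa using (continuous_inv (G := G)).tendsto 1
    exact ht.eventually h1
  filter_upwards [h1, h2] with k hk1 hk2 g
  by_cases hg : g ∈ tsupport φ
  · exact hk1 g hg
  by_cases hkg : k * g ∈ tsupport φ
  · have := hk2 _ hkg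
    rwa [inv_mul_cancel_left, abs_sub_comm] at this
  · rw [image_eq_zero_of_notMem_tsupport hg, image_eq_zero_of_notMem_tsupport hkg]
    simpa using hε

section Separation

variable {G : Type u} [Group G] [TopologicalSpace G] [IsTopologicalGroup G] [LocallyCompactSpace G]
  {X : Type u} [TopologicalSpace X] [CompactSpace X] [T2Space X] [MulAction G X]
  [ContinuousSMul G X]

/-- In the Furstenberg boundary, open sets that are disjoint up to a neighbourhood of the identity
have disjoint closures. -/
theorem IsFurstenbergBoundary.disjoint_closure (hX : IsFurstenbergBoundary G X) {U W : Set X}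
    (hU : IsOpen U) (hW : IsOpen W) {V : Set G} (hV : V ∈ 𝓝 (1 : G))
    (hd : ∀ v ∈ V, ∀ x ∈ U, v • x ∉ W) : Disjoint (closure U) (closure W) := by
  obtain ⟨φ, hφ1, hφ, hφV, hφu⟩ := exists_bump_uniformContinuous hV
  -- The supremum over `g` of `φ g` times the indicator of `g • U` is `1` on `U` because `φ 1 = 1`,
  -- and `0` on `W` because `g • U` meets `W` only for `g ∉ V`. Translation by `k` replaces `φ g` by
  -- `φ (k * g)`, so it inherits the uniform continuity of `φ`.
  let F : G → X → ℝ := fun g x => ((g • ·) '' U).indicator (fun _ => φ g) x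
  have hF : ∀ g x, F g x ∈ Icc (0 : ℝ) 1 := by
    intro g x
    by_cases hx : x ∈ (g • ·) '' U
    · have : F g x = φ g := by simp only [F]; exact indicator_of_mem hx _
      exact this ▸ hφ g
    · have : F g x = 0 := by simp only [F]; exact indicator_of_notMem hx _
      rw [this]
      exact ⟨le_rfl, zero_le_one⟩
  have hbdd : ∀ x, BddAbove (range fun g => F g x) := fun x =>
    ⟨1, by rintro _ ⟨g, rfl⟩; exact (hF g x).2⟩
  let f₀ : X → ℝ := fun x => ⨆ g, F g x
  have hf₀ : ∀ x, f₀ x ∈ Icc (0 : ℝ) 1 := fun x =>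
    ⟨le_ciSup_of_le (hbdd x) 1 (hF 1 x).1, ciSup_le fun g => (hF g x).2⟩
  let f : X → unitInterval := fun x => ⟨f₀ x, hf₀ x⟩
  have hlsc : LowerSemicontinuous fun x => (f x : ℝ) :=
    lowerSemicontinuous_ciSup hbdd fun g =>
      ((isOpenMap_smul g) U hU).lowerSemicontinuous_indicator (hφ g).1
  have htrans : ∀ (k g : G) (x : X), k • x ∈ (fun y => (k * g) • y) '' U ↔
      x ∈ (g • ·) '' U := by
    intro k g x
    constructor
    · rintro ⟨y, hy, h⟩
      exact ⟨y, hy, by simpa [mul_smul] using h⟩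
    · rintro ⟨y, hy, rfl⟩
      exact ⟨y, hy, by simp [mul_smul]⟩
  have hle : ∀ (ε : ℝ) (k : G), (∀ g, |φ (k * g) - φ g| < ε) → 0 < ε → ∀ x,
      f₀ (k • x) ≤ f₀ x + ε := by
    intro ε k hk hε x
    refine ciSup_le fun g => ?_
    by_cases hx : k • x ∈ (g • ·) '' U
    · have hx' : x ∈ ((k⁻¹ * g) • ·) '' U := by
        rw [← htrans k]; simpa using hx
      have h1 : F g (k • x) = φ g := by simp only [F]; exact indicator_of_mem hx _
      have h2 : F (k⁻¹ * g) x = φ (k⁻¹ * g) := by simp only [F]; exact indicator_of_mem hx' _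
      have h3 := le_ciSup (hbdd x) (k⁻¹ * g)
      have h4 := hk (k⁻¹ * g)
      rw [mul_inv_cancel_left] at h4
      have h5 := (abs_lt.1 h4).2
      simp only [h2] at h3
      rw [h1]
      change φ (k⁻¹ * g) ≤ f₀ x at h3
      linarith
    · have h1 : F g (k • x) = 0 := by simp only [F]; exact indicator_of_notMem hx _
      rw [h1]
      linarith [(hf₀ x).1]
  have hequi : ∀ ε : ℝ, 0 < ε → ∀ᶠ k : G in 𝓝 1, ∀ x, dist (f (k • x)) (f x) ≤ ε := by
    intro ε hε
    have ht : Tendsto (fun k : G => k⁻¹) (𝓝 1) (𝓝 1) := by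
      simpa using (continuous_inv (G := G)).tendsto 1
    filter_upwards [hφu ε hε, ht.eventually (hφu ε hε)] with k hk1 hk2 x
    have h1 := hle ε k hk1 hε x
    have h2 := hle ε k⁻¹ hk2 hε (k • x)
    rw [inv_smul_smul] at h2
    change |f₀ (k • x) - f₀ x| ≤ ε
    exact abs_le.2 ⟨by linarith, by linarith⟩
  obtain ⟨f', hf', hff'⟩ := hX.exists_continuous_modification hlsc hequi
  have hfU : ∀ x ∈ U, f x = 1 := by
    intro x hx
    refine Subtype.ext (le_antisymm (hf₀ x).2 (le_ciSup_of_le (hbdd x) 1 ?_))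
    have hx' : x ∈ ((1 : G) • ·) '' U := ⟨x, hx, one_smul G x⟩
    have : F 1 x = φ 1 := by simp only [F]; exact indicator_of_mem hx' _
    rw [this, hφ1]; rfl
  have hfW : ∀ x ∈ W, f x = 0 := by
    intro x hx
    refine Subtype.ext (le_antisymm (ciSup_le fun g => ?_) (hf₀ x).1)
    by_cases hg : x ∈ (g • ·) '' U
    · have : F g x = φ g := by simp only [F]; exact indicator_of_mem hg _
      rw [this, hφV g]
      · rfl
      · intro hgV
        obtain ⟨y, hy, rfl⟩ := hg
        exact hd g hgV y hy hx
    · have : F g x = 0 := by simp only [F]; exact indicator_of_notMem hg _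
      rw [this]; rfl
  have hU' : closure U ⊆ {x | f' x = 1} := closure_minimal
    (fun x hx => hff' x 1 (mem_of_superset (hU.mem_nhds hx) hfU)) (isClosed_eq hf' continuous_const)
  have hW' : closure W ⊆ {x | f' x = 0} := closure_minimal
    (fun x hx => hff' x 0 (mem_of_superset (hW.mem_nhds hx) hfW)) (isClosed_eq hf' continuous_const)
  refine disjoint_left.2 fun x hxU hxW => ?_
  have h1 : f' x = 1 := hU' hxU
  have h2 : f' x = 0 := hW' hxW
  rw [h1] at h2
  exact one_ne_zero h2

end Separation

/-! ### Colouring the complement of a fixed point set -/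

section Colouring

variable {G : Type*} [Group G] {X : Type*} [TopologicalSpace X] [MulAction G X]

/-- There is a maximal open set `U` disjoint from `S` with `Q • U` disjoint from `U`. -/
theorem exists_maximal_open_disjoint (Q : Set G) (S : Set X) :
    ∃ U : Set X, Maximal (fun U => IsOpen U ∧ Disjoint U S ∧ ∀ q ∈ Q, ∀ x ∈ U, q • x ∉ U) U := by
  obtain ⟨U, hU⟩ := zorn_subset {U : Set X | IsOpen U ∧ Disjoint U S ∧
      ∀ q ∈ Q, ∀ x ∈ U, q • x ∉ U} (by
    intro c hc hchain
    refine ⟨⋃₀ c, ⟨isOpen_sUnion fun t ht => (hc ht).1,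
      disjoint_sUnion_left.2 fun t ht => (hc ht).2.1, ?_⟩, fun t ht => subset_sUnion_of_mem ht⟩
    rintro q hq x ⟨s, hs, hxs⟩ ⟨t, ht, hxt⟩
    rcases hchain.total hs ht with h | h
    · exact (hc ht).2.2 q hq x (h hxs) hxt
    · exact (hc hs).2.2 q hq x hxs (h hxt))
  exact ⟨U, hU⟩

variable [TopologicalSpace G] [IsTopologicalGroup G] [T2Space X] [ContinuousSMul G X]

/-- Points that are moved by every element of the compact set `Q` can be covered, up to closure, by
thickenings of finitely many open sets `U` with `Q • U` disjoint from `U`. -/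
theorem exists_finite_colouring {Q W : Set G} (hQ : IsCompact Q) (hW : W ∈ 𝓝 (1 : G)) :
    ∃ (n : ℕ) (U : ℕ → Set X), (∀ i, IsOpen (U i) ∧ ∀ q ∈ Q, ∀ x ∈ U i, q • x ∉ U i) ∧
      {x : X | ∀ q ∈ Q, q • x ≠ x} ⊆ ⋃ i ∈ Finset.range n, closure (W • U i) := by
  choose m hm using exists_maximal_open_disjoint (X := X) Q
  -- A greedy choice: `S n` is the union of `W • U j` over `j < n`, and `U n` is maximal among the
  -- admissible open sets avoiding it.
  let S : ℕ → Set X := fun n => Nat.rec ∅ (fun _ s => s ∪ W • m s) n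
  let U : ℕ → Set X := fun n => m (S n)
  have hS : ∀ n, S (n + 1) = S n ∪ W • U n := fun n => rfl
  have hSmono : Monotone S := monotone_nat_of_le_succ fun n => by
    rw [hS]; exact subset_union_left
  have hUopen : ∀ n, IsOpen (U n) := fun n => (hm (S n)).prop.1
  have hUS : ∀ n, Disjoint (U n) (S n) := fun n => (hm (S n)).prop.2.1
  have hUQ : ∀ n, ∀ q ∈ Q, ∀ x ∈ U n, q • x ∉ U n := fun n => (hm (S n)).prop.2.2
  have hsep : ∀ i j, j < i → Disjoint (U i) (W • U j) := fun i j hij =>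
    (hUS i).mono_right ((subset_union_right.trans (hS j).ge).trans (hSmono hij))
  -- a finite cover of `Q ∪ Q⁻¹` by small translates
  obtain ⟨W₀, hW₀, hW₀o, h1W₀, hW₀W⟩ : ∃ W₀ : Set G, W₀ ∈ 𝓝 (1 : G) ∧ IsOpen W₀ ∧ (1 : G) ∈ W₀ ∧
      ∀ a ∈ W₀, ∀ b ∈ W₀, a * b⁻¹ ∈ W := by
    have : Tendsto (fun p : G × G => p.1 * p.2⁻¹) (𝓝 (1, 1)) (𝓝 1) := by
      have h : Continuous fun p : G × G => p.1 * p.2⁻¹ := by fun_prop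
      simpa using h.tendsto (1, 1)
    obtain ⟨A, hA, B, hB, hAB⟩ := mem_nhds_prod_iff.1 (this hW)
    obtain ⟨W₀, h1, h2, h3⟩ := mem_nhds_iff.1 (inter_mem hA hB)
    exact ⟨W₀, h2.mem_nhds h3, h2, h3, fun a ha b hb =>
      hAB (mk_mem_prod (h1 ha).1 (h1 hb).2)⟩
  obtain ⟨T, hT⟩ := (hQ.union hQ.inv).elim_finite_subcover (fun t : G => {q | q * t⁻¹ ∈ W₀})
    (fun t => hW₀o.preimage (continuous_mul_const t⁻¹))
    (fun q _ => mem_iUnion.2 ⟨q, by simpa using h1W₀⟩)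
  -- One colour more than there are translates, for the pigeonhole principle at the end.
  refine ⟨T.card + 1, U, fun i => ⟨hUopen i, hUQ i⟩, fun y hy => ?_⟩
  by_contra hcov
  let D : Set X := {x : X | ∀ q ∈ Q, q • x ≠ x} ∩
    ⋂ i ∈ Finset.range (T.card + 1), (closure (W • U i))ᶜ
  have hAopen : IsOpen {x : X | ∀ q ∈ Q, q • x ≠ x} := by
    rw [isOpen_iff_eventually]
    intro x hx
    refine IsCompact.eventually_forall_of_forall_eventually hQ fun q hq => ?_
    have : IsOpen {z : X × G | z.2 • z.1 ≠ z.1} :=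
      isOpen_ne_fun (continuous_snd.smul continuous_fst) continuous_fst
    exact this.mem_nhds (hx q hq)
  have hD : IsOpen D := hAopen.inter (isOpen_biInter_finset fun i _ => isClosed_closure.isOpen_compl)
  have hyD : y ∈ D := ⟨hy, by simpa using hcov⟩
  let R : ℕ → Set X := fun i => (Q ∪ Q⁻¹) • U i
  have hWsub : ∀ i, U i ⊆ W • U i := fun i x hx =>
    ⟨1, mem_of_mem_nhds hW, x, hx, one_smul G x⟩
  have hDS : ∀ n ≤ T.card + 1, Disjoint D (S n) := by
    intro n hn
    induction n with
    | zero => exact disjoint_empty D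
    | succ n ih =>
      rw [hS]
      refine disjoint_union_right.2 ⟨ih (by omega), disjoint_left.2 fun z hz hzW => ?_⟩
      have := mem_iInter₂.1 hz.2 n (Finset.mem_range.2 (by omega))
      exact this (subset_closure hzW)
  have hR : ∀ i ∈ Finset.range (T.card + 1), D ⊆ closure (R i) := by
    intro i hi x hx
    by_contra hxR
    have hxi : x ∉ closure (W • U i) := by
      have := mem_iInter₂.1 hx.2 i hi
      exact this
    -- a small neighbourhood of `x` could be added to `U i`
    have hQx : ∃ B ∈ 𝓝 x, ∀ q ∈ Q, ∀ b ∈ B, ∀ b' ∈ B, q • b ≠ b' := by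
      have h1 : ∀ᶠ z : X × X in 𝓝 (x, x), ∀ q ∈ Q, q • z.1 ≠ z.2 := by
        refine IsCompact.eventually_forall_of_forall_eventually hQ fun q hq => ?_
        have : IsOpen {z : (X × X) × G | z.2 • z.1.1 ≠ z.1.2} :=
          isOpen_ne_fun (continuous_snd.smul (continuous_fst.comp continuous_fst))
            (continuous_snd.comp continuous_fst)
        exact this.mem_nhds (hx.1 q hq)
      obtain ⟨A, hA, B, hB, hAB⟩ := mem_nhds_prod_iff.1 h1
      exact ⟨A ∩ B, inter_mem hA hB, fun q hq b hb b' hb' =>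
        hAB (mk_mem_prod hb.1 hb'.2) q hq⟩
    obtain ⟨B₀, hB₀, hQB₀⟩ := hQx
    let B : Set X := D ∩ interior B₀ ∩ (closure (R i))ᶜ
    have hBopen : IsOpen B := (hD.inter isOpen_interior).inter isClosed_closure.isOpen_compl
    have hBR : ∀ z ∈ B, z ∉ R i := fun z hz h => hz.2 (subset_closure h)
    have hB0 : ∀ z ∈ B, z ∈ B₀ := fun z hz => interior_subset hz.1.2
    have hmax := (hm (S i)).le_of_ge (y := U i ∪ B) ⟨(hUopen i).union hBopen, ?_, ?_⟩
      subset_union_left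
    · exact hxi (subset_closure (hWsub i (hmax (Or.inr
        ⟨⟨hx, mem_interior_iff_mem_nhds.2 hB₀⟩, hxR⟩))))
    · refine disjoint_union_left.2 ⟨hUS i, (hDS i ?_).mono_left fun z hz => hz.1.1⟩
      exact (Finset.mem_range.1 hi).le
    · rintro q hq z (hz | hz) (hqz | hqz)
      · exact hUQ i q hq z hz hqz
      · exact hBR _ hqz ⟨q, Or.inl hq, z, hz, rfl⟩
      · exact hBR _ hz ⟨q⁻¹, Or.inr (inv_mem_inv.2 hq), q • z, hqz, inv_smul_smul q z⟩
      · exact hQB₀ q hq z (hB0 z hz) _ (hB0 _ hqz) rfl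
  have hRopen : ∀ i, IsOpen (R i) := fun i => (hUopen i).smul_left
  -- By maximality each open set `R i` is dense in `D`, so finitely many of them meet there; a
  -- common point `z` is carried into every `U i` by `Q ∪ Q⁻¹`.
  have hmeet : ∀ n ≤ T.card + 1, IsOpen (D ∩ ⋂ i ∈ Finset.range n, R i) ∧
      (D ∩ ⋂ i ∈ Finset.range n, R i).Nonempty := by
    intro n hn
    refine ⟨hD.inter (isOpen_biInter_finset fun i _ => hRopen i), ?_⟩
    induction n with
    | zero => exact ⟨y, hyD, by simp⟩
    | succ n ih =>
      obtain ⟨z, hz⟩ := ih (by omega)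
      obtain ⟨z', hz', hzR⟩ := mem_closure_iff.1 (hR n (Finset.mem_range.2 (by omega)) hz.1) _
        (hD.inter (isOpen_biInter_finset fun i (_ : i ∈ Finset.range n) => hRopen i)) hz
      refine ⟨z', hz'.1, mem_iInter₂.2 fun i hi => ?_⟩
      rcases Nat.lt_succ_iff_lt_or_eq.1 (Finset.mem_range.1 hi) with h | rfl
      · exact mem_iInter₂.1 hz'.2 i (Finset.mem_range.2 h)
      · exact hzR
  obtain ⟨z, hz⟩ := (hmeet _ le_rfl).2
  have hp : ∀ i, ∃ p : G, ∃ t : G, i ∈ Finset.range (T.card + 1) →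
      p • z ∈ U i ∧ t ∈ T ∧ p * t⁻¹ ∈ W₀ := by
    intro i
    by_cases hi : i ∈ Finset.range (T.card + 1)
    · obtain ⟨q, hq, u, hu, rfl⟩ := mem_iInter₂.1 hz.2 i hi
      have hq' : q⁻¹ ∈ Q ∪ Q⁻¹ := hq.elim (fun h => Or.inr (inv_mem_inv.2 h)) fun h => Or.inl h
      obtain ⟨t, ht, hqt⟩ := mem_iUnion₂.1 (hT hq')
      exact ⟨q⁻¹, t, fun _ => ⟨by simpa using hu, ht, hqt⟩⟩
    · exact ⟨1, 1, fun h => absurd h hi⟩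
  -- Two colours share a translate `t`, so `p i * (p j)⁻¹` lies in `W` and `p i • z` lies in both `U
  -- i` and `W • U j`, although the later colour avoids the thickening of the earlier one.
  choose p t hpt using hp
  obtain ⟨i, hi, j, hj, hij, htij⟩ := Finset.exists_ne_map_eq_of_card_lt_of_maps_to
    (s := Finset.range (T.card + 1)) (t := T) (by simp) (f := t) (fun i hi => (hpt i hi).2.1)
  have main : ∀ i j, i ∈ Finset.range (T.card + 1) → j ∈ Finset.range (T.card + 1) → t i = t j →
      ¬ j < i := by
    intro i j hi hj htij hlt
    have h1 := hW₀W _ (hpt i hi).2.2 _ (hpt j hj).2.2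
    have h2 : p i * (t i)⁻¹ * (p j * (t j)⁻¹)⁻¹ = p i * (p j)⁻¹ := by rw [htij]; group
    rw [h2] at h1
    refine disjoint_left.1 (hsep i j hlt) (hpt i hi).1 ⟨_, h1, _, (hpt j hj).1, ?_⟩
    simp [mul_smul]
  rcases lt_or_gt_of_ne hij with h | h
  · exact main j i hj hi htij.symm h
  · exact main i j hi hj htij h

end Colouring

/-! ### Continuity of the stabilizer map -/

section Continuity

variable {G : Type u} [Group G] [TopologicalSpace G] [IsTopologicalGroup G] [LocallyCompactSpace G]
  {X : Type u} [TopologicalSpace X] [CompactSpace X] [T2Space X] [MulAction G X]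
  [ContinuousSMul G X]

theorem IsFurstenbergBoundary.eventually_exists_smul_eq (hX : IsFurstenbergBoundary G X)
    {g : G} {x : X} (hgx : g • x = x) {O : Set G} (hO : O ∈ 𝓝 g) :
    ∀ᶠ y in 𝓝 x, ∃ q ∈ O, q • y = y := by
  obtain ⟨K, hK, hK1, hKO⟩ : ∃ K : Set G, IsCompact K ∧ K ∈ 𝓝 (1 : G) ∧
      ∀ a ∈ K, ∀ b ∈ K, ∀ c ∈ K, a⁻¹ * b * g * c ∈ O := by
    have ht : Tendsto (fun p : G × G × G => p.1⁻¹ * p.2.1 * g * p.2.2) (𝓝 (1, 1, 1)) (𝓝 g) := by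
      have h : Continuous fun p : G × G × G => p.1⁻¹ * p.2.1 * g * p.2.2 := by fun_prop
      simpa using h.tendsto (1, 1, 1)
    obtain ⟨A, hA, B', hB', hAB⟩ := mem_nhds_prod_iff.1 (ht hO)
    obtain ⟨B, hB, C, hC, hBC⟩ := mem_nhds_prod_iff.1 hB'
    obtain ⟨K, hK, hKsub, hKc⟩ := local_compact_nhds (inter_mem hA (inter_mem hB hC))
    exact ⟨K, hKc, hK, fun a ha b hb c hc => hAB (mk_mem_prod (hKsub ha).1
      (hBC (mk_mem_prod (hKsub hb).2.1 (hKsub hc).2.2)))⟩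
  -- This shape of `Q` says exactly that `Q • U` disjoint from `U` means `K • g • K • U` disjoint
  -- from `K • U`, the hypothesis of `disjoint_closure` for `g • K • U` and `K • U`.
  let Q : Set G := (fun p : G × G × G => p.1⁻¹ * p.2.1 * g * p.2.2) '' (K ×ˢ K ×ˢ K)
  have hQ : IsCompact Q := (hK.prod (hK.prod hK)).image (by fun_prop)
  have hQO : Q ⊆ O := by
    rintro _ ⟨⟨a, b, c⟩, ⟨ha, hb, hc⟩, rfl⟩
    exact hKO a ha b hb c hc
  obtain ⟨n, U, hU, hcov⟩ := exists_finite_colouring (X := X) hQ hK1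
  by_contra hcon
  have hx : x ∈ closure (⋃ i ∈ Finset.range n, closure (K • U i)) := by
    rw [mem_closure_iff_frequently]
    exact (not_eventually.1 hcon).mono fun y hy => hcov fun q hq hqy => hy ⟨q, hQO hq, hqy⟩
  rw [(isClosed_biUnion_finset fun i _ => isClosed_closure).closure_eq] at hx
  obtain ⟨i, -, hxi⟩ := mem_iUnion₂.1 hx
  have hopen : IsOpen (K • U i) := (hU i).1.smul_left
  have hgx' : x ∈ closure ((fun y => g • y) '' (K • U i)) := by
    have := image_closure_subset_closure_image (continuous_const_smul (T := X) g)
      (mem_image_of_mem _ hxi)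
    rwa [hgx] at this
  refine disjoint_left.1 (hX.disjoint_closure ((isOpenMap_smul g) _ hopen) hopen hK1 ?_) hgx' hxi
  rintro v hv _ ⟨_, ⟨c, hc, u, hu, rfl⟩, rfl⟩ ⟨a, ha, u', hu', h⟩
  refine (hU i).2 (a⁻¹ * v * g * c) ⟨(a, v, c), ⟨ha, hv, hc⟩, rfl⟩ u hu ?_
  have : (a⁻¹ * v * g * c) • u = u' := by
    rw [mul_smul, mul_smul, mul_smul, inv_smul_eq_iff]
    exact h.symm
  rwa [this]

theorem IsFurstenbergBoundary.continuous_stabilizerMap [T2Space G]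
    (hX : IsFurstenbergBoundary G X) : Continuous (stabilizerMap G X) := by
  rw [continuous_induced_rng, continuous_generateFrom_iff]
  rintro S (⟨K, hK, rfl⟩ | ⟨O, hO, rfl⟩)
  -- The compact half of the subbasis needs only a continuous action on a Hausdorff space.
  · rw [isOpen_iff_eventually]
    intro x hx
    have hx' : ∀ g ∈ K, g • x ≠ x := fun g hg h =>
      eq_empty_iff_forall_notMem.1 hx g ⟨h, hg⟩
    have : ∀ᶠ y in 𝓝 x, ∀ g ∈ K, g • y ≠ y := by
      refine IsCompact.eventually_forall_of_forall_eventually hK fun g hg => ?_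
      have : IsOpen {z : X × G | z.2 • z.1 ≠ z.1} :=
        isOpen_ne_fun (continuous_snd.smul continuous_fst) continuous_fst
      exact this.mem_nhds (hx' g hg)
    filter_upwards [this] with y hy
    exact eq_empty_iff_forall_notMem.2 fun g hg => hy g hg.2 hg.1
  · rw [isOpen_iff_eventually]
    rintro x ⟨g, hgx, hgO⟩
    filter_upwards [hX.eventually_exists_smul_eq (show g • x = x from hgx) (hO.mem_nhds hgO)]
      with y ⟨q, hq, hqy⟩
    exact ⟨q, hqy, hq⟩

end Continuity

/-! ### Freeness -/

section Freeness

variable {G : Type*} [Group G] {X Y : Type*} [TopologicalSpace X] [TopologicalSpace Y]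
  [MulAction G X] [MulAction G Y]

theorem IsFreeAction.isTopologicallyFree [TopologicalSpace G] (h : IsFreeAction G X) :
    IsTopologicallyFree G X := by
  intro K _ h1
  have : {x : X | ∃ g ∈ K, x = g • x} = ∅ := eq_empty_iff_forall_notMem.2 (by
    rintro x ⟨g, hg, hgx⟩
    have : g ∈ MulAction.stabilizer G x := hgx.symm
    rw [h x, Subgroup.mem_bot] at this
    exact h1 (this ▸ hg))
  rw [this, interior_empty]

/-- An equivariant continuous surjection from a compact minimal flow maps sets with nonempty
interior to sets whose closure has nonempty interior. -/
theorem nonempty_interior_image [CompactSpace X] [MulAction.IsMinimal G X] [ContinuousConstSMul G X]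
    [ContinuousConstSMul G Y] [BaireSpace Y] [Nonempty Y] {f : X → Y}
    (hf : Function.Surjective f) (hfe : ∀ (g : G) x, f (g • x) = g • f x)
    {O : Set X} (hO : IsOpen O) (hne : O.Nonempty) : (interior (closure (f '' O))).Nonempty := by
  obtain ⟨T, hT⟩ := isCompact_univ.exists_finite_cover_smul G hO hne
  by_contra hemp
  have hnd : IsNowhereDense (f '' O) := not_nonempty_iff_eq_empty.1 hemp
  have hm : IsMeagre (⋃ g ∈ T, (fun y => g⁻¹ • y) ⁻¹' (f '' O)) :=
    isMeagre_biUnion T.countable_toSet fun g _ =>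
      hnd.isMeagre.preimage_of_isOpenMap (continuous_const_smul g⁻¹) (isOpenMap_smul g⁻¹)
  refine not_isMeagre_of_isOpen isOpen_univ univ_nonempty (hm.mono fun y _ => ?_)
  obtain ⟨x, rfl⟩ := hf y
  obtain ⟨g, hg, z, hz, rfl⟩ := mem_iUnion₂.1 (hT (mem_univ x))
  refine mem_iUnion₂.2 ⟨g, hg, z, hz, ?_⟩
  simp [hfe]

end Freeness

theorem IsFurstenbergBoundary.isFreeAction {G : Type u} [Group G] [TopologicalSpace G]
    [IsTopologicalGroup G] [LocallyCompactSpace G] [T2Space G]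
    {X Y : Type u} [TopologicalSpace X] [CompactSpace X] [T2Space X] [MulAction G X]
    [ContinuousSMul G X] [TopologicalSpace Y] [CompactSpace Y] [T2Space Y] [MulAction G Y]
    [ContinuousSMul G Y] (hX : IsFurstenbergBoundary G X) (hY : IsBoundary G Y)
    (hYfree : IsTopologicallyFree G Y) : IsFreeAction G X := by
  intro x
  rw [eq_bot_iff]
  intro g hg
  rw [Subgroup.mem_bot]
  by_contra hg1
  obtain ⟨f, hf, hfs⟩ := hX.isFactor_of_isBoundary Y hY
  have := hX.isBoundary.minimal
  have := hY.nonempty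
  obtain ⟨K, hK, hKsub, hKc⟩ := local_compact_nhds (isOpen_ne.mem_nhds hg1 : {h : G | h ≠ 1} ∈ 𝓝 g)
  obtain ⟨O, hOsub, hO, hxO⟩ := mem_nhds_iff.1
    (hX.eventually_exists_smul_eq (MulAction.mem_stabilizer_iff.1 hg) hK)
  have hcl : IsClosed {y : Y | ∃ g ∈ K, y = g • y} := by
    rw [← isOpen_compl_iff, isOpen_iff_eventually]
    intro y hy
    have hy' : ∀ g ∈ K, y ≠ g • y := fun g hg h => hy ⟨g, hg, h⟩
    have : ∀ᶠ z in 𝓝 y, ∀ g ∈ K, z ≠ g • z := by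
      refine IsCompact.eventually_forall_of_forall_eventually hKc fun g hg => ?_
      have : IsOpen {z : Y × G | z.1 ≠ z.2 • z.1} :=
        isOpen_ne_fun continuous_fst (continuous_snd.smul continuous_fst)
      exact this.mem_nhds (hy' g hg)
    filter_upwards [this] with z hz
    rintro ⟨g, hg, h⟩
    exact hz g hg h
  have hsub : closure (f '' O) ⊆ {y : Y | ∃ g ∈ K, y = g • y} := by
    refine closure_minimal ?_ hcl
    rintro _ ⟨z, hz, rfl⟩
    obtain ⟨q, hq, hqz⟩ := hOsub hz
    exact ⟨q, hq, by rw [← map_smul, hqz]⟩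
  have h0 := hYfree K hKc fun h => hKsub h rfl
  have h1 := nonempty_interior_image hfs (fun g x => map_smul f g x) hO ⟨x, hxO⟩
  exact (h1.mono (interior_mono hsub)).ne_empty h0

theorem mainTheorem3 (G : Type u) [Group G] [TopologicalSpace G] [IsTopologicalGroup G]
    [LocallyCompactSpace G] [T2Space G] :
    (∃ (X : Type u) (_ : TopologicalSpace X) (_ : CompactSpace X) (_ : T2Space X)
        (_ : MulAction G X) (_ : ContinuousSMul G X), IsFurstenbergBoundary G X) ∧
    ∀ (X : Type u) [TopologicalSpace X] [CompactSpace X] [T2Space X]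
      [MulAction G X] [ContinuousSMul G X], IsFurstenbergBoundary G X →
      Continuous (stabilizerMap G X) ∧
      ((∃ (Y : Type u) (_ : TopologicalSpace Y) (_ : CompactSpace Y) (_ : T2Space Y)
          (_ : MulAction G Y) (_ : ContinuousSMul G Y),
          IsBoundary G Y ∧ IsTopologicallyFree G Y) ↔
        IsFreeAction G X) := by
  refine ⟨exists_isFurstenbergBoundary G, fun X _ _ _ _ _ hX =>
    ⟨hX.continuous_stabilizerMap, ?_, fun h => ?_⟩⟩
  · rintro ⟨Y, _, _, _, _, _, hY, hYfree⟩
    exact hX.isFreeAction hY hYfree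
  · exact ⟨X, _, ‹_›, ‹_›, _, ‹_›, hX.isBoundary, h.isTopologicallyFree⟩
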